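/- A bijective solution to the Pentagon Equation (PE) is a nonempty set $S$ with a bijection $s:S\times S\to S\times S$ such that $s_{23}s_{13}s_{12}=s_{12}s_{23}$ on $S^3$. Write $s(x,y)=(x\cdot y,\theta_x(y))$ and $s^{-1}(x,y)=(\psi_y(x),y\circ x)$, let $E=\{e\in S: e\cdot e=e\}$, and put $1=\theta_{e_0}(e_0)$ for some $e_0\in E$. The solution is irretractable if $e\cdot g=f\cdot g$ whenever $e,f\in E$ satisfy $\theta_e=\theta_f$ and $g\in 1\cdot S$. Two solutions $(S,s)$, $(S',s')$ are isomorphic if there is a bijection $f:S\to S'$ with $(f\times f)s=s'(f\times f)$. A matched pair of groups $(A,G,\sigma,\delta)$ consists of groups $A,G$, a left action $\sigma:A\to\mathrm{Sym}(G)$ and a right action $\delta:G\to\mathrm{Sym}(A)$ with $\sigma_a(xy)=\sigma_a(x)\sigma_{\delta_x(a)}(y)$ and $\delta_x(ab)=\delta_{\sigma_b(x)}(a)\,\delta_x(b)$. An isomorphism from $(A,G,\sigma,\delta)$ to $(A',G',\sigma',\delta')$ is a map $f=f_1\times f_2:A\times G\to A'\times G'$ with group isomorphisms $f_1:A\to A'$,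 $f_2:G\to G'$ such that $f_2(\sigma_a(x))=\sigma'_{f_1(a)}(f_2(x))$ and $f_1(\delta_x(a))=\delta'_{f_2(x)}(f_1(a))$ for all $a\in A$, $x\in G$. The matched pair associated with a finite irretractable bijective solution $(S,s)$ is $A=1\circ S$ with the operation $\circ$, $G=1\cdot S$ with the operation $\cdot$, $\sigma_a(x)=1\cdot\theta_a(x)$ and $\delta_x(a)=\bigl(1\circ\psi_{x^{-1}}(a^{-1})\bigr)^{-1}$ (inverses taken in $G$ and $A$). Proposition. Let $(S,s)$ and $(S',s')$ be finite irretractable bijective solutions to the PE. If they are isomorphic as solutions, then these data do form matched pairs of groups, and the matched pairs of groups associated with $(S,s)$ and $(S',s')$ are isomorphic. -/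

import Mathlib

namespace PentagonEq

universe u v w z

section Solutions

variable {S : Type u}

/-- `s₁₂` on `S × S × S`. -/
def map12 (s : S × S → S × S) (p : S × S × S) : S × S × S :=
  ((s (p.1, p.2.1)).1, (s (p.1, p.2.1)).2, p.2.2)

/-- `s₁₃` on `S × S × S`. -/
def map13 (s : S × S → S × S) (p : S × S × S) : S × S × S :=
  ((s (p.1, p.2.2)).1, p.2.1, (s (p.1, p.2.2)).2)

/-- `s₂₃` on `S × S × S`. -/
def map23 (s : S × S → S × S) (p : S × S × S) : S × S × S :=
  (p.1, s p.2)

/-- `(S, s)` is a set-theoretic solution to the Pentagon Equation: `s₂₃ s₁₃ s₁₂ = s₁₂ s₂₃`. -/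
def IsSolution (s : S × S → S × S) : Prop :=
  map23 s ∘ map13 s ∘ map12 s = map12 s ∘ map23 s

/-- `f` is a homomorphism of solutions `(S, s) → (T, t)`: `(f × f) ∘ s = t ∘ (f × f)`. -/
def IsSolutionHom {T : Type v} (s : S × S → S × S) (t : T × T → T × T) (f : S → T) : Prop :=
  Prod.map f f ∘ s = t ∘ Prod.map f f

/-- Two solutions are isomorphic if there is a bijective homomorphism of solutions. -/
def AreIsomorphic {T : Type v} (s : S × S → S × S) (t : T × T → T × T) : Prop :=
  ∃ f : S → T, Function.Bijective f ∧ IsSolutionHom s t f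

/-- The product `x · y`, where `s (x, y) = (x · y, θ_x(y))`. -/
def dot (s : S × S → S × S) (x y : S) : S := (s (x, y)).1

/-- The map `θ_x`, where `s (x, y) = (x · y, θ_x(y))`. -/
def theta (s : S × S → S × S) (x y : S) : S := (s (x, y)).2

/-- The product `y ∘ x`, where `s⁻¹ (x, y) = (ψ_y(x), y ∘ x)`. -/
def circ (s : Equiv.Perm (S × S)) (y x : S) : S := (s.symm (x, y)).2

/-- The map `ψ_y`, where `s⁻¹ (x, y) = (ψ_y(x), y ∘ x)`. -/
def psi (s : Equiv.Perm (S × S)) (y x : S) : S := (s.symm (x, y)).1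

/-- `e ∈ E(S, ·)`. -/
def IsIdem (s : S × S → S × S) (e : S) : Prop := dot s e e = e

/-- `e` can serve as the distinguished element `1`: it has the form `θ_{e₀}(e₀)` with
`e₀ ∈ E(S, ·)`. -/
def IsBasePoint (s : S × S → S × S) (e : S) : Prop :=
  ∃ e₀ : S, IsIdem s e₀ ∧ e = theta s e₀ e₀

/-- The set `G = 1 · S`, for the distinguished element `e = 1`. -/
def setG (s : S × S → S × S) (e : S) : Set S := Set.range fun y => dot s e y

/-- The set `A = 1 ∘ S`, for the distinguished element `e = 1`. -/
def setA (s : Equiv.Perm (S × S)) (e : S) : Set S := Set.range fun y => circ s e y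

/-- The relation whose quotient is the retract: for `e, f ∈ E(S, ·)` and `g, h ∈ G = 1 · S`,
`e · g ≈ f · h` means `θ_e = θ_f` and `g = h`. (For finite bijective solutions the relation does
not depend on the choice of the distinguished element `1`.) -/
def RetractRel (s : S × S → S × S) (x y : S) : Prop :=
  ∃ i e f g : S, IsBasePoint s i ∧ IsIdem s e ∧ IsIdem s f ∧ g ∈ setG s i ∧
    theta s e = theta s f ∧ x = dot s e g ∧ y = dot s f g

/-- A solution is irretractable if it equals its retract, i.e. `≈` is equality. -/
def IsIrretractable (s : S × S → S × S) : Prop :=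
  ∀ x y : S, RetractRel s x y → x = y

end Solutions

/-- A matched pair of groups `(A, G, σ, δ)`: a left action `σ : A → Sym(G)` and a right action
`δ : G → Sym(A)` on the underlying sets satisfying the two compatibility conditions. The right
action is a homomorphism from the opposite group; `δ_x(a)` is `δ (MulOpposite.op x) a`. -/
structure MatchedPair (A : Type u) (G : Type v) [Group A] [Group G] where
  σ : A →* Equiv.Perm G
  δ : Gᵐᵒᵖ →* Equiv.Perm A
  σ_mul : ∀ (a : A) (x y : G), σ a (x * y) = σ a x * σ (δ (MulOpposite.op x) a) y
  δ_mul : ∀ (x : G) (a b : A),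
    δ (MulOpposite.op x) (a * b) =
      δ (MulOpposite.op (σ b x)) a * δ (MulOpposite.op x) b

/-- `f : A × G → A' × G'` is an isomorphism of matched pairs of groups. -/
def IsMatchedPairIso {A : Type u} {G : Type v} {A' : Type w} {G' : Type z}
    [Group A] [Group G] [Group A'] [Group G']
    (M : MatchedPair A G) (M' : MatchedPair A' G') (f : A × G → A' × G') : Prop :=
  ∃ (f₁ : A ≃* A') (f₂ : G ≃* G'), f = Prod.map f₁ f₂ ∧
    (∀ (a : A) (x : G), f₂ (M.σ a x) = M'.σ (f₁ a) (f₂ x)) ∧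
    (∀ (a : A) (x : G),
      f₁ (M.δ (MulOpposite.op x) a) = M'.δ (MulOpposite.op (f₂ x)) (f₁ a))

/-- The matched pair of groups associated with a (finite irretractable) bijective solution
`(S, s)`: with `1 = θ_{e₀}(e₀)`, it consists of the group `A = 1 ∘ S` under `∘`, the group
`G = 1 · S` under `·`, and
`σ_a(x) = 1 · θ_a(x)`, `δ_x(a) = (1 ∘ ψ_{x⁻¹}(a⁻¹))⁻¹` (inverses in the groups `G` and `A`).
A term is a proof that these prescribed data do form a matched pair; everything in it is
determined by `s` once `1` is chosen. -/
structure AssociatedMatchedPair {S : Type u} (s : Equiv.Perm (S × S)) where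
  one : S
  isBasePoint_one : IsBasePoint s one
  [groupA : Group (setA s one)]
  [groupG : Group (setG s one)]
  coe_mulA : ∀ a b : setA s one, ((a * b : setA s one) : S) = circ s a b
  coe_mulG : ∀ x y : setG s one, ((x * y : setG s one) : S) = dot s x y
  pair : MatchedPair (setA s one) (setG s one)
  coe_σ : ∀ (a : setA s one) (x : setG s one), (pair.σ a x : S) = dot s one (theta s a x)
  coe_δ_inv : ∀ (x : setG s one) (a : setA s one),
    (((pair.δ (MulOpposite.op x) a)⁻¹ : setA s one) : S) =
      circ s one (psi s (x⁻¹ : setG s one) (a⁻¹ : setA s one))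

attribute [instance] AssociatedMatchedPair.groupA AssociatedMatchedPair.groupG

end PentagonEq

namespace PentagonEq

universe u v

/-! ### Components of the Pentagon Equation and of `s⁻¹`. -/

section Axioms

variable {S : Type u} {s : Equiv.Perm (S × S)}

/-! Finiteness makes right ideals of `(S, ·)` prime on the left (`mem_of_dot_mem`), so every right
translation is bijective (`dot_left_surjective`). Hence idempotents are right identities, each `θ_x`
is injective (`theta_injective`) and `θ_1 = id`. Irretractability says that an idempotent is
determined by its `θ` (`isIdem_ext`). So `1` is unique, `A` is the set of idempotents, and `θ_{a∘b}
= θ_a θ_b` embeds `A` in the permutations of `S`. Identities in `A` then become identities between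
maps `θ`. In this picture `δ_x(a)` is the idempotent with the same `θ` as `a · x`, and compatibility
follows from the Pentagon Equation. An isomorphism of solutions respects all operations and sends
`1` to a base point, which uniqueness identifies with the other `1`; its restrictions to `A` and `G`
are the required isomorphisms. -/

theorem dot_assoc (hs : IsSolution s) (x y z : S) :
    dot s (dot s x y) z = dot s x (dot s y z) :=
  congrArg (fun p => p.1) (congrFun hs (x, y, z))

theorem theta_dot (hs : IsSolution s) (x y z : S) :
    theta s x (dot s y z) = dot s (theta s x y) (theta s (dot s x y) z) :=
  (congrArg (fun p => p.2.1) (congrFun hs (x, y, z))).symm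

theorem theta_theta (hs : IsSolution s) (x y z : S) :
    theta s (theta s x y) (theta s (dot s x y) z) = theta s y z :=
  congrArg (fun p => p.2.2) (congrFun hs (x, y, z))

theorem exists_dot_theta (s : Equiv.Perm (S × S)) (u v : S) :
    ∃ x y, dot s x y = u ∧ theta s x y = v := by
  refine ⟨(s.symm (u, v)).1, (s.symm (u, v)).2, ?_, ?_⟩ <;> simp [dot, theta]

theorem apply_eq {x y u v : S} (h₁ : dot s x y = u) (h₂ : theta s x y = v) :
    s (x, y) = (u, v) :=
  Prod.ext h₁ h₂

theorem eq_of_dot_eq_of_theta_eq {x y x' y' : S} (h₁ : dot s x y = dot s x' y')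
    (h₂ : theta s x y = theta s x' y') : x = x' ∧ y = y' :=
  Prod.ext_iff.1 (s.injective (Prod.ext h₁ h₂ : s (x, y) = s (x', y')))

theorem circ_eq {x y u v : S} (h₁ : dot s x y = u) (h₂ : theta s x y = v) :
    circ s v u = y := by
  rw [circ, ← apply_eq h₁ h₂, Equiv.symm_apply_apply]

theorem psi_eq {x y u v : S} (h₁ : dot s x y = u) (h₂ : theta s x y = v) :
    psi s v u = x := by
  rw [psi, ← apply_eq h₁ h₂, Equiv.symm_apply_apply]

theorem dot_mem_setG (hs : IsSolution s) {i x y : S} (hx : x ∈ setG s i) : dot s x y ∈ setG s i := by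
  obtain ⟨z, rfl⟩ := hx
  exact ⟨dot s z y, (dot_assoc hs _ _ _).symm⟩

end Axioms

/-! ### Idempotents, translations and the maps `θ`. -/

section Finite

variable {S : Type u} [Finite S] {s : Equiv.Perm (S × S)}

/-- In a finite bijective solution, right ideals of `(S, ·)` are prime on the left factor. -/
theorem mem_of_dot_mem {I : Set S} (hI : ∀ x ∈ I, ∀ y, dot s x y ∈ I) {x y : S}
    (h : dot s x y ∈ I) : x ∈ I := by
  -- `s` maps the finite set `I × S` injectively into itself, hence onto itself, so nothing outside
  -- enters it.
  have hm : Set.MapsTo s (Prod.fst ⁻¹' I) (Prod.fst ⁻¹' I) := fun p hp => hI p.1 hp p.2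
  have hsurj : Set.SurjOn s (Prod.fst ⁻¹' I) (Prod.fst ⁻¹' I) :=
    ((Set.toFinite _).surjOn_iff_bijOn_of_mapsTo hm |>.2
      ((Set.toFinite _).injOn_iff_bijOn_of_mapsTo hm |>.1 s.injective.injOn))
  obtain ⟨p, hp, hpe⟩ := hsurj (show s (x, y) ∈ Prod.fst ⁻¹' I from h)
  have : p = (x, y) := s.injective hpe
  subst this
  exact hp

theorem exists_isIdem [Nonempty S] (hs : IsSolution s) : ∃ e, IsIdem s e := by
  let : Semigroup S := { mul := dot s, mul_assoc := dot_assoc hs }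
  let : TopologicalSpace S := ⊥
  have : DiscreteTopology S := ⟨rfl⟩
  exact exists_idempotent_of_compact_t2_of_continuous_mul_left
    (M := S) fun _ => continuous_of_discreteTopology

theorem dot_eq_self_of_dot_dot_eq_self (hs : IsSolution s) {e x y : S}
    (h : dot s e (dot s x y) = dot s x y) : dot s e x = x :=
  mem_of_dot_mem (s := s) (I := {z | dot s e z = z})
    (fun z hz w => by rw [Set.mem_ofPred_eq, ← dot_assoc hs, hz]) h

theorem exists_theta_dot_eq (hs : IsSolution s) {e : S} (he : IsIdem s e) (v : S) :
    ∃ x, dot s (theta s e x) v = theta s e e := by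
  obtain ⟨x, y, h₁, h₂⟩ := exists_dot_theta s e v
  have hx : dot s e x = x := by
    apply dot_eq_self_of_dot_dot_eq_self hs (y := y)
    rw [h₁]; exact he
  refine ⟨x, ?_⟩
  have := theta_dot hs e x y
  rw [hx, h₁, h₂] at this
  exact this.symm

/-- `(S, ·)` is left simple. -/
theorem dot_left_surjective [Nonempty S] (hs : IsSolution s) (v : S) :
    Function.Surjective fun x => dot s x v := by
  obtain ⟨e, he⟩ := exists_isIdem hs
  set q := theta s e e
  have hqv : ∀ v, ∃ p, dot s p v = q := fun v =>
    let ⟨x, hx⟩ := exists_theta_dot_eq hs he v; ⟨_, hx⟩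
  -- The left ideal `S · q` is also a right ideal, so primeness forces it to be all of `S`.
  have hright : ∀ x ∈ Set.range (fun a => dot s a q), ∀ t,
      dot s x t ∈ Set.range (fun a => dot s a q) := by
    rintro _ ⟨a, rfl⟩ t
    obtain ⟨c, hc⟩ := hqv (dot s (dot s q q) t)
    obtain ⟨b, hb⟩ : ∃ b, dot s (dot s b q) t = q :=
      ⟨dot s c q, by simpa only [dot_assoc hs] using hc⟩
    obtain ⟨r, hr⟩ := hqv (dot s b q)
    have hqt : dot s q t = dot s r q := by
      conv_lhs => rw [← hr]
      rw [dot_assoc hs, hb]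
    exact ⟨dot s a r, by simp only [dot_assoc hs, hqt]⟩
  intro x
  have hx : x ∈ Set.range fun a => dot s a q := mem_of_dot_mem hright (y := q) ⟨x, rfl⟩
  obtain ⟨a, rfl⟩ := hx
  obtain ⟨p, hp⟩ := hqv v
  exact ⟨dot s a p, by simp only [dot_assoc hs, hp]⟩

theorem dot_right_cancel (hs : IsSolution s) {x y v : S} (h : dot s x v = dot s y v) : x = y :=
  have : Nonempty S := ⟨x⟩
  Finite.injective_iff_surjective.2 (dot_left_surjective hs v) h

theorem dot_isIdem (hs : IsSolution s) {e : S} (he : IsIdem s e) (x : S) : dot s x e = x :=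
  dot_right_cancel hs (v := e) (by rw [dot_assoc hs, he])

theorem isIdem_of_dot_eq_right (hs : IsSolution s) {e x : S} (h : dot s e x = x) : IsIdem s e :=
  dot_right_cancel hs (v := x) (by rw [dot_assoc hs, h, h])

theorem isIdem_of_dot_eq_left (hs : IsSolution s) {e x : S} (h : dot s x e = x) :
    IsIdem s e := by
  have : Nonempty S := ⟨x⟩
  obtain ⟨p, hp⟩ := dot_left_surjective hs x e
  change dot s p x = e at hp
  rw [IsIdem]
  nth_rw 1 [← hp]
  rw [dot_assoc hs, h, hp]

theorem exists_isIdem_dot_eq (hs : IsSolution s) (x : S) : ∃ e, IsIdem s e ∧ dot s e x = x := by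
  have : Nonempty S := ⟨x⟩
  obtain ⟨e, he⟩ := dot_left_surjective hs x x
  exact ⟨e, isIdem_of_dot_eq_right hs he, he⟩

theorem isIdem_theta (hs : IsSolution s) {f : S} (hf : IsIdem s f) (b : S) :
    IsIdem s (theta s b f) := by
  obtain ⟨x, y, h₁, -⟩ := exists_dot_theta s b b
  have := theta_dot hs x y f
  rw [dot_isIdem hs hf, h₁] at this
  exact isIdem_of_dot_eq_left hs this.symm

/-- Since `s (b, e) = (b, θ_b(e))` for idempotent `e`, injectivity of `s` makes `θ_b` permute the
finite set of idempotents. -/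
theorem exists_isIdem_theta_eq (hs : IsSolution s) (b : S) {f : S} (hf : IsIdem s f) :
    ∃ e, IsIdem s e ∧ theta s b e = f := by
  have hm : Set.MapsTo (theta s b) {e | IsIdem s e} {e | IsIdem s e} :=
    fun e he => isIdem_theta hs he b
  have hinj : Set.InjOn (theta s b) {e | IsIdem s e} := fun e he e' he' h =>
    (eq_of_dot_eq_of_theta_eq ((dot_isIdem hs he b).trans (dot_isIdem hs he' b).symm) h).2
  exact ((Set.toFinite _).surjOn_iff_bijOn_of_mapsTo hm |>.2
    ((Set.toFinite _).injOn_iff_bijOn_of_mapsTo hm |>.1 hinj)) hf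

theorem theta_isIdem_dot (hs : IsSolution s) (x : S) {f : S} (hf : IsIdem s f) (z : S) :
    theta s x (dot s f z) = dot s (theta s x f) (theta s x z) := by
  rw [theta_dot hs, dot_isIdem hs hf]

theorem theta_surjective_of_isIdem (hs : IsSolution s) {e : S} (he : IsIdem s e) :
    Function.Surjective (theta s e) := by
  intro w
  have : Nonempty S := ⟨w⟩
  have hq : IsIdem s (theta s e e) := isIdem_theta hs he e
  obtain ⟨f, hf, hfw⟩ := exists_isIdem_dot_eq hs w
  obtain ⟨v, hv⟩ := dot_left_surjective hs w (theta s e e)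
  change dot s v w = _ at hv
  obtain ⟨x, hx⟩ := exists_theta_dot_eq hs he v
  obtain ⟨h, hh, hhf⟩ := exists_isIdem_theta_eq hs e hf
  have key : theta s e x = dot s (theta s e e) w := by
    conv_rhs => rw [← hx]
    rw [dot_assoc hs, hv, dot_isIdem hs hq]
  refine ⟨dot s h x, ?_⟩
  rw [theta_isIdem_dot hs e hh, hhf, key, ← dot_assoc hs, dot_isIdem hs hq, hfw]

theorem theta_injective (hs : IsSolution s) (x : S) : Function.Injective (theta s x) := by
  have : Nonempty S := ⟨x⟩
  obtain ⟨e, he⟩ := exists_isIdem hs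
  intro y z h
  apply Finite.injective_iff_surjective.2 (theta_surjective_of_isIdem hs he)
  have hy := theta_theta hs x e y
  have hz := theta_theta hs x e z
  rw [dot_isIdem hs he] at hy hz
  rw [← hy, ← hz, h]

/-! ### The element `1` and the groups `A` and `G`. -/

theorem IsBasePoint.isIdem (hs : IsSolution s) {i : S} (hi : IsBasePoint s i) : IsIdem s i := by
  obtain ⟨e, he, rfl⟩ := hi
  exact isIdem_theta hs he e

theorem IsBasePoint.theta_eq (hs : IsSolution s) {i : S} (hi : IsBasePoint s i) (z : S) :
    theta s i z = z := by
  obtain ⟨e, he, rfl⟩ := hi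
  obtain ⟨w, rfl⟩ := theta_surjective_of_isIdem hs he z
  have := theta_theta hs e e w
  rwa [he] at this

theorem exists_isBasePoint [Nonempty S] (hs : IsSolution s) : ∃ i, IsBasePoint s i :=
  let ⟨e, he⟩ := exists_isIdem hs; ⟨_, e, he, rfl⟩

theorem mem_setG_iff (hs : IsSolution s) {i : S} (hi : IsBasePoint s i) {x : S} :
    x ∈ setG s i ↔ dot s i x = x := by
  refine ⟨?_, fun h => ⟨x, h⟩⟩
  rintro ⟨y, rfl⟩
  change dot s i (dot s i y) = dot s i y
  rw [← dot_assoc hs, hi.isIdem hs]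

theorem isIdem_ext (hs : IsSolution s) (hirr : IsIrretractable s) {e f : S} (he : IsIdem s e)
    (hf : IsIdem s f) (h : theta s e = theta s f) : e = f := by
  have : Nonempty S := ⟨e⟩
  obtain ⟨i, hi⟩ := exists_isBasePoint hs
  have hii := hi.isIdem hs
  exact hirr e f ⟨i, e, f, i, hi, he, hf, (mem_setG_iff hs hi).2 hii, h,
    (dot_isIdem hs hii e).symm, (dot_isIdem hs hii f).symm⟩

theorem IsBasePoint.unique (hs : IsSolution s) (hirr : IsIrretractable s) {i j : S}
    (hi : IsBasePoint s i) (hj : IsBasePoint s j) : i = j :=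
  isIdem_ext hs hirr (hi.isIdem hs) (hj.isIdem hs)
    (funext fun z => (hi.theta_eq hs z).trans (hj.theta_eq hs z).symm)

variable {i : S}

theorem theta_of_mem_setG (hs : IsSolution s) (hi : IsBasePoint s i) {x : S}
    (hx : x ∈ setG s i) (z : S) : theta s x z = z := by
  have := theta_theta hs i x z
  rw [hi.theta_eq hs, (mem_setG_iff hs hi).1 hx] at this
  exact theta_injective hs x this

/-- Inverts `θ_{x·h}` explicitly, by `θ_{θ_x(h)}`. -/
theorem theta_theta_of_mem_setG (hs : IsSolution s) (hi : IsBasePoint s i) (x : S) {h : S}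
    (hh : h ∈ setG s i) (z : S) : theta s (theta s x h) (theta s (dot s x h) z) = z := by
  rw [theta_theta hs, theta_of_mem_setG hs hi hh]

theorem theta_dot_congr (hs : IsSolution s) (hi : IsBasePoint s i) {x x' h : S}
    (hh : h ∈ setG s i) (hx : theta s x = theta s x') :
    theta s (dot s x h) = theta s (dot s x' h) := by
  funext z
  apply theta_injective hs (theta s x h)
  rw [theta_theta_of_mem_setG hs hi x hh, hx, theta_theta_of_mem_setG hs hi x' hh]

theorem circ_isIdem (hs : IsSolution s) {a b : S} (ha : IsIdem s a) :
    IsIdem s (circ s a b) ∧ theta s b (circ s a b) = a := by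
  obtain ⟨q, hq, hqa⟩ := exists_isIdem_theta_eq hs b ha
  rw [circ_eq (dot_isIdem hs hq b) hqa]
  exact ⟨hq, hqa⟩

theorem theta_circ (hs : IsSolution s) {a b : S} (ha : IsIdem s a) (z : S) :
    theta s (circ s a b) z = theta s a (theta s b z) := by
  obtain ⟨h, h'⟩ := circ_isIdem hs ha (b := b)
  rw [← theta_theta hs b, h', dot_isIdem hs h]

theorem theta_circ_basePoint (hs : IsSolution s) (hi : IsBasePoint s i) (x : S) :
    theta s (circ s i x) = theta s x := by
  funext z
  rw [theta_circ hs (hi.isIdem hs), hi.theta_eq hs]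

theorem circ_basePoint (hs : IsSolution s) (hirr : IsIrretractable s) (hi : IsBasePoint s i)
    {e : S} (he : IsIdem s e) : circ s i e = e :=
  isIdem_ext hs hirr (circ_isIdem hs (hi.isIdem hs)).1 he (theta_circ_basePoint hs hi e)

theorem mem_setA_iff (hs : IsSolution s) (hirr : IsIrretractable s) (hi : IsBasePoint s i)
    {a : S} : a ∈ setA s i ↔ IsIdem s a := by
  refine ⟨?_, fun h => ⟨a, circ_basePoint hs hirr hi h⟩⟩
  rintro ⟨y, rfl⟩
  exact (circ_isIdem hs (hi.isIdem hs)).1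

theorem exists_dot_eq_basePoint (hs : IsSolution s) (hi : IsBasePoint s i) (x : S) :
    ∃ y ∈ setG s i, dot s y x = i := by
  have : Nonempty S := ⟨x⟩
  obtain ⟨y, hy⟩ := dot_left_surjective hs x i
  refine ⟨dot s i y, ⟨y, rfl⟩, ?_⟩
  rw [dot_assoc hs]
  change dot s i ((fun y => dot s y x) y) = i
  rw [hy, hi.isIdem hs]

/-- The group `(1 · S, ·)`. -/
noncomputable abbrev groupSetG (hs : IsSolution s) (hi : IsBasePoint s i) : Group (setG s i) :=
  letI : Mul (setG s i) := ⟨fun x y => ⟨dot s x y, dot_mem_setG hs x.2⟩⟩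
  letI : One (setG s i) := ⟨⟨i, (mem_setG_iff hs hi).2 (hi.isIdem hs)⟩⟩
  letI : Inv (setG s i) := ⟨fun x => ⟨(exists_dot_eq_basePoint hs hi x).choose,
    (exists_dot_eq_basePoint hs hi x).choose_spec.1⟩⟩
  Group.ofLeftAxioms (fun x y z => Subtype.ext (dot_assoc hs x y z))
    (fun x => Subtype.ext ((mem_setG_iff hs hi).1 x.2))
    (fun x => Subtype.ext (exists_dot_eq_basePoint hs hi x).choose_spec.2)

/-- The group `(1 ∘ S, ∘)`. -/
noncomputable abbrev groupSetA (hs : IsSolution s) (hirr : IsIrretractable s)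
    (hi : IsBasePoint s i) : Group (setA s i) :=
  have hA : ∀ {a : S}, a ∈ setA s i ↔ IsIdem s a := mem_setA_iff hs hirr hi
  letI : Mul (setA s i) := ⟨fun a b => ⟨circ s a b, hA.2 (circ_isIdem hs (hA.1 a.2)).1⟩⟩
  letI : One (setA s i) := ⟨⟨i, hA.2 (hi.isIdem hs)⟩⟩
  letI : Inv (setA s i) := ⟨fun a => ⟨theta s a i, hA.2 (isIdem_theta hs (hi.isIdem hs) a)⟩⟩
  Group.ofLeftAxioms
    (fun a b c => Subtype.ext <| isIdem_ext hs hirr (hA.1 (Subtype.mem _)) (hA.1 (Subtype.mem _))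
      (funext fun z => by
        change theta s (circ s (circ s a b) c) z = theta s (circ s a (circ s b c)) z
        rw [theta_circ hs (circ_isIdem hs (hA.1 a.2)).1, theta_circ hs (hA.1 a.2),
          theta_circ hs (hA.1 a.2), theta_circ hs (hA.1 b.2)]))
    (fun a => Subtype.ext (circ_basePoint hs hirr hi (hA.1 a.2)))
    (fun a => Subtype.ext <| isIdem_ext hs hirr (hA.1 (Subtype.mem _)) (hi.isIdem hs)
      (funext fun z => by
        change theta s (circ s (theta s a i) a) z = theta s i z
        rw [theta_circ hs (isIdem_theta hs (hi.isIdem hs) a), ← theta_theta hs a i,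
          dot_isIdem hs (hi.isIdem hs)]))

theorem dot_theta_dot (hs : IsSolution s) (hi : IsBasePoint s i) (a y : S) :
    dot s i (theta s a (dot s i y)) = dot s i (theta s a y) := by
  rw [theta_isIdem_dot hs a (hi.isIdem hs), ← dot_assoc hs,
    dot_isIdem hs (isIdem_theta hs (hi.isIdem hs) a)]

theorem theta_inv_dot (hs : IsSolution s) (hi : IsBasePoint s i) {a b x : S}
    (hab : ∀ z, theta s b (theta s a z) = z) (hx : x ∈ setG s i) (z : S) :
    theta s (dot s b (theta s a x)) (theta s (dot s a x) z) = z := by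
  have h := theta_theta hs b (theta s a x) (theta s (dot s a x) z)
  rwa [hab, theta_of_mem_setG hs hi hx, theta_theta_of_mem_setG hs hi a hx] at h

/-! ### Construction of the matched pair. -/

theorem nonempty_associatedMatchedPair [Nonempty S] (hs : IsSolution s)
    (hirr : IsIrretractable s) : Nonempty (AssociatedMatchedPair s) := by
  obtain ⟨i, hi⟩ := exists_isBasePoint hs
  have hii := hi.isIdem hs
  have hA : ∀ {a : S}, a ∈ setA s i ↔ IsIdem s a := mem_setA_iff hs hirr hi
  have hG : ∀ {a : S}, a ∈ setG s i ↔ dot s i a = a := mem_setG_iff hs hi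
  let := groupSetA hs hirr hi
  let := groupSetG hs hi
  have mulA : ∀ a b : setA s i, ((a * b : setA s i) : S) = circ s a b := fun _ _ => rfl
  have mulG : ∀ a b : setG s i, ((a * b : setG s i) : S) = dot s a b := fun _ _ => rfl
  have oneA : ((1 : setA s i) : S) = i := rfl
  have oneG : ((1 : setG s i) : S) = i := rfl
  have extA : ∀ {a b : setA s i}, (∀ z, theta s a z = theta s b z) → a = b := fun {a b} h =>
    Subtype.ext (isIdem_ext hs hirr (hA.1 a.2) (hA.1 b.2) (funext h))
  let σ₀ : setA s i →* Function.End (setG s i) :=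
    { toFun := fun a x => ⟨dot s i (theta s a x), ⟨_, rfl⟩⟩
      map_one' := by
        funext x
        apply Subtype.ext
        change dot s i (theta s i x) = x
        rw [hi.theta_eq hs, hG.1 x.2]
      map_mul' := fun a b => by
        funext x
        apply Subtype.ext
        change dot s i (theta s (circ s a b) x) = dot s i (theta s a (dot s i (theta s b x)))
        rw [dot_theta_dot hs hi, theta_circ hs (hA.1 a.2)] }
  -- The action is defined without inverses, as `1 ∘ (a · x)`; the prescribed formula through `ψ` is
  -- checked at the end.
  let δ₀ : (setG s i)ᵐᵒᵖ →* Function.End (setA s i) :=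
    { toFun := fun x a => ⟨circ s i (dot s a x.unop), ⟨_, rfl⟩⟩
      map_one' := by
        funext a
        apply Subtype.ext
        change circ s i (dot s a i) = a
        rw [dot_isIdem hs hii, circ_basePoint hs hirr hi (hA.1 a.2)]
      map_mul' := fun x y => by
        funext a
        apply extA
        intro z
        change theta s (circ s i (dot s a (dot s y.unop x.unop))) z =
          theta s (circ s i (dot s (circ s i (dot s a y.unop)) x.unop)) z
        rw [theta_circ_basePoint hs hi, theta_circ_basePoint hs hi,
          theta_dot_congr hs hi x.unop.2 (theta_circ_basePoint hs hi (dot s a y.unop)),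
          dot_assoc hs] }
  have hσ : ∀ (a : setA s i) (x : setG s i),
      (σ₀.toHomPerm a x : S) = dot s i (theta s a x) := fun _ _ => rfl
  have hδ : ∀ (a : setA s i) (x : setG s i),
      (δ₀.toHomPerm (MulOpposite.op x) a : S) = circ s i (dot s a x) := fun _ _ => rfl
  refine ⟨{ one := i, isBasePoint_one := hi, coe_mulA := mulA, coe_mulG := mulG,
            pair := { σ := σ₀.toHomPerm, δ := δ₀.toHomPerm, σ_mul := ?_, δ_mul := ?_ },
            coe_σ := hσ, coe_δ_inv := ?_ }⟩
  · intro a x y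
    apply Subtype.ext
    rw [mulG, hσ, hσ, hσ, hδ, mulG, theta_circ_basePoint hs hi, theta_dot hs, dot_assoc hs,
      ← dot_assoc hs _ i, dot_isIdem hs hii]
  · intro x a b
    apply extA
    intro z
    rw [hδ, mulA, mulA, hδ, theta_circ hs (circ_isIdem hs hii).1, hδ, hσ,
      theta_circ_basePoint hs hi, theta_circ_basePoint hs hi, theta_circ_basePoint hs hi]
    -- Applying `θ_{θ_{a∘b}(x)}` turns both sides into `z`.
    apply theta_injective hs (theta s (circ s a b) x)
    rw [theta_theta_of_mem_setG hs hi _ x.2, theta_circ hs (hA.1 a.2), ← dot_assoc hs _ i,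
      dot_isIdem hs hii, theta_theta hs, theta_theta_of_mem_setG hs hi _ x.2]
  · intro x a
    have hab : ∀ z, theta s (a⁻¹ : setA s i) (theta s a z) = z := fun z => by
      rw [← theta_circ hs (hA.1 (a⁻¹ : setA s i).2), ← mulA, inv_mul_cancel, oneA,
        hi.theta_eq hs]
    set b : S := ((a⁻¹ : setA s i) : S)
    -- `p` is the value of `ψ_{x⁻¹}(a⁻¹)`: the goal is `s (p, f · g⁻¹) = (a⁻¹, x⁻¹)`, with `f` the
    -- idempotent for which `θ_p(f) = 1`.
    set p := dot s b (theta s a x)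
    set g : setG s i := ⟨dot s i (theta s a x), ⟨_, rfl⟩⟩
    have hpg : p = dot s b g := by
      change _ = dot s b (dot s i (theta s a x))
      rw [← dot_assoc hs, dot_isIdem hs hii]
    obtain ⟨f, hf, hfp⟩ := exists_isIdem_theta_eq hs p hii
    have hgi : dot s g (g⁻¹ : setG s i) = i := by rw [← mulG, mul_inv_cancel, oneG]
    have hdot : dot s p (dot s f (g⁻¹ : setG s i)) = b := by
      rw [← dot_assoc hs, dot_isIdem hs hf, hpg, dot_assoc hs, hgi, dot_isIdem hs hii]
    have htheta : theta s p (dot s f (g⁻¹ : setG s i)) = (x⁻¹ : setG s i) := by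
      rw [theta_isIdem_dot hs p hf, hfp]
      set w : setG s i := ⟨dot s i (theta s p (g⁻¹ : setG s i)), ⟨_, rfl⟩⟩
      suffices x * w = 1 by
        rw [← eq_inv_of_mul_eq_one_right this]
      apply Subtype.ext
      rw [mulG, oneG]
      change dot s x (dot s i (theta s p (g⁻¹ : setG s i))) = i
      rw [← dot_assoc hs, dot_isIdem hs hii]
      have h := theta_dot hs b g (g⁻¹ : setG s i)
      have h' : theta s b g = dot s (theta s b i) x := by
        change theta s b (dot s i (theta s a x)) = _
        rw [theta_isIdem_dot hs b hii, hab]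
      rw [hgi, h', ← hpg, dot_assoc hs] at h
      have h2 := congrArg (dot s i) h
      rw [← dot_assoc hs i, dot_isIdem hs (isIdem_theta hs hii b), ← dot_assoc hs,
        hG.1 x.2] at h2
      exact h2.symm
    rw [psi_eq hdot htheta]
    set c : setA s i := ⟨circ s i p, ⟨_, rfl⟩⟩
    suffices c * δ₀.toHomPerm (MulOpposite.op x) a = 1 by
      rw [← eq_inv_of_mul_eq_one_left this]
    apply extA
    intro z
    rw [mulA, theta_circ hs (hA.1 c.2), hδ, oneA, hi.theta_eq hs, theta_circ_basePoint hs hi,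
      theta_circ_basePoint hs hi, theta_inv_dot hs hi hab x.2]

end Finite

/-! ### Transport along an isomorphism of solutions. -/

section Isomorphism

variable {S : Type u} {T : Type v} {s : Equiv.Perm (S × S)} {t : Equiv.Perm (T × T)}
  {f : S → T}

theorem IsSolutionHom.map_dot (hf : IsSolutionHom s t f) (x y : S) :
    f (dot s x y) = dot t (f x) (f y) :=
  congrArg Prod.fst (congrFun hf (x, y))

theorem IsSolutionHom.map_theta (hf : IsSolutionHom s t f) (x y : S) :
    f (theta s x y) = theta t (f x) (f y) :=
  congrArg Prod.snd (congrFun hf (x, y))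

theorem IsSolutionHom.map_symm (hf : IsSolutionHom s t f) (x y : S) :
    t.symm (f x, f y) = Prod.map f f (s.symm (x, y)) := by
  rw [Equiv.symm_apply_eq]
  have := congrFun hf (s.symm (x, y))
  simp only [Function.comp_apply, Equiv.apply_symm_apply] at this
  exact this

theorem IsSolutionHom.map_circ (hf : IsSolutionHom s t f) (x y : S) :
    f (circ s x y) = circ t (f x) (f y) := by
  rw [circ, circ, hf.map_symm, Prod.map_snd]

theorem IsSolutionHom.map_psi (hf : IsSolutionHom s t f) (x y : S) :
    f (psi s x y) = psi t (f x) (f y) := by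
  rw [psi, psi, hf.map_symm, Prod.map_fst]

theorem IsSolutionHom.map_isBasePoint (hf : IsSolutionHom s t f) {i : S}
    (hi : IsBasePoint s i) : IsBasePoint t (f i) := by
  obtain ⟨e, he, rfl⟩ := hi
  refine ⟨f e, ?_, hf.map_theta e e⟩
  rw [IsIdem, ← hf.map_dot, he]

theorem IsSolutionHom.image_setG (hf : IsSolutionHom s t f) (hb : Function.Surjective f) (i : S) :
    f '' setG s i = setG t (f i) := by
  rw [setG, setG, ← Set.range_comp, ← hb.range_comp]
  exact congrArg Set.range (funext fun y => hf.map_dot i y)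

theorem IsSolutionHom.image_setA (hf : IsSolutionHom s t f) (hb : Function.Surjective f) (i : S) :
    f '' setA s i = setA t (f i) := by
  rw [setA, setA, ← Set.range_comp, ← hb.range_comp]
  exact congrArg Set.range (funext fun y => hf.map_circ i y)

theorem IsSolutionHom.exists_isMatchedPairIso (hf : IsSolutionHom s t f)
    (hb : Function.Bijective f) (M : AssociatedMatchedPair s) (N : AssociatedMatchedPair t)
    (h : f M.one = N.one) :
    ∃ F : setA s M.one × setG s M.one → setA t N.one × setG t N.one,
      IsMatchedPairIso M.pair N.pair F := by
  let F₁ : setA s M.one ≃ setA t N.one :=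
    ((Equiv.ofBijective f hb).image _).trans
      (Equiv.setCongr ((hf.image_setA hb.2 M.one).trans (by rw [h])))
  let F₂ : setG s M.one ≃ setG t N.one :=
    ((Equiv.ofBijective f hb).image _).trans
      (Equiv.setCongr ((hf.image_setG hb.2 M.one).trans (by rw [h])))
  have hF₁ : ∀ a, (F₁ a : T) = f a := fun _ => rfl
  have hF₂ : ∀ x, (F₂ x : T) = f x := fun _ => rfl
  let f₁ : setA s M.one ≃* setA t N.one :=
    { F₁ with
      map_mul' := fun a b => Subtype.ext <| by
        change f _ = _
        rw [M.coe_mulA, N.coe_mulA, hf.map_circ]; rfl }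
  let f₂ : setG s M.one ≃* setG t N.one :=
    { F₂ with
      map_mul' := fun a b => Subtype.ext <| by
        change f _ = _
        rw [M.coe_mulG, N.coe_mulG, hf.map_dot]; rfl }
  have hf₁ : ∀ a, (f₁ a : T) = f a := fun _ => rfl
  have hf₂ : ∀ x, (f₂ x : T) = f x := fun _ => rfl
  refine ⟨_, f₁, f₂, rfl, fun a x => Subtype.ext ?_, fun a x => ?_⟩
  · rw [hf₂, M.coe_σ, N.coe_σ, hf.map_dot, hf.map_theta, h, hf₁, hf₂]
  -- `δ` is prescribed only through its inverse, so inverses are compared.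
  · rw [← inv_inj, ← map_inv]
    apply Subtype.ext
    rw [hf₁, M.coe_δ_inv, N.coe_δ_inv, hf.map_circ, hf.map_psi, h, ← map_inv, ← map_inv, hf₁, hf₂]

end Isomorphism

end PentagonEq

theorem mainTheorem8 {S : Type*} {S' : Type*} [Finite S] [Finite S'] [Nonempty S] [Nonempty S']
    (s : Equiv.Perm (S × S)) (s' : Equiv.Perm (S' × S'))
    (hs : PentagonEq.IsSolution s) (hs' : PentagonEq.IsSolution s')
    (hirr : PentagonEq.IsIrretractable s) (hirr' : PentagonEq.IsIrretractable s')
    (hiso : PentagonEq.AreIsomorphic s s') :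
    Nonempty (PentagonEq.AssociatedMatchedPair s) ∧
    Nonempty (PentagonEq.AssociatedMatchedPair s') ∧
    ∀ (M : PentagonEq.AssociatedMatchedPair s) (M' : PentagonEq.AssociatedMatchedPair s'),
      ∃ f : PentagonEq.setA s M.one × PentagonEq.setG s M.one →
          PentagonEq.setA s' M'.one × PentagonEq.setG s' M'.one,
        PentagonEq.IsMatchedPairIso M.pair M'.pair f := by
  refine ⟨PentagonEq.nonempty_associatedMatchedPair hs hirr,
    PentagonEq.nonempty_associatedMatchedPair hs' hirr', fun M M' => ?_⟩
  obtain ⟨f, hb, hf⟩ := hiso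
  exact hf.exists_isMatchedPairIso hb M M' <|
    (hf.map_isBasePoint M.isBasePoint_one).unique hs' hirr' M'.isBasePoint_one
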